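/- Write $\mathbb{F}=\mathbb{F}_2$ and, for a finite set $X$, $\mathbb{E}_{x\in X}=\frac1{|X|}\sum_{x\in X}$. For $P:\mathbb{F}^n\to\mathbb{F}$ and $h\in\mathbb{F}^n$ let $D_hP(x)=P(x+h)-P(x)$, and let $\mathcal{P}_d(\mathbb{F}^n)$ be the set of all $P:\mathbb{F}^n\to\mathbb{F}$ with $D_{h_1}\cdots D_{h_{d+1}}P=0$ for all $h_1,\dots,h_{d+1}\in\mathbb{F}^n$. For $f:\mathbb{F}^n\to\mathbb{C}$ let $\Delta_hf(x)=f(x+h)\overline{f(x)}$, and for $d\ge 1$ define $$\|f\|_{U^d}=\Bigl|\mathbb{E}_{h_1,\dots,h_d,x\in\mathbb{F}^n}\Delta_{h_1}\cdots\Delta_{h_d}f(x)\Bigr|^{1/2^d},\qquad \|f\|_{u^d}=\sup_{Q\in\mathcal{P}_{d-1}(\mathbb{F}^n)}\Bigl|\mathbb{E}_{x\in\mathbb{F}^n}f(x)(-1)^{-Q(x)}\Bigr|.$$ The rank $\mathrm{rank}_d(P)$ is the least $k\ge0$ such that $P=B(Q_1,\dots,Q_k)$ for some $Q_1,\dots,Q_k\in\mathcal{P}_d(\mathbb{F}^n)$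 and some function $B:\mathbb{F}^k\to\mathbb{F}$ (and $\infty$ if there is no such $k$). The inverse conjecture for the $U^d$-norm over $\mathbb{F}_2$ is the assertion that for every $\delta\in(0,1]$ there is $c=c(d,\delta)>0$ such that, for all $n$ and all $f:\mathbb{F}^n\to\mathbb{C}$ with $|f|\le1$ and $\|f\|_{U^d}\ge\delta$, one has $\|f\|_{u^d}\ge c$. **Theorem.** For $n\ge1$ and $d\ge1$ let $S_d(x)=\sum_{1\le i_1<\dots<i_d\le n}x_{i_1}\cdots x_{i_d}$ be the $d$-th elementary symmetric function on $\mathbb{F}_2^n$ and let $f=f_{n,d}=(-1)^{S_d}$. 1. If $d=1$ or $d=2$, then $\|f\|_{U^d}\to0$ and $\|f\|_{u^d}\to0$ as $n\to\infty$. 2. If $d$ is not a power of $2$ (where $1=2^0$ counts as a power of $2$), then for every $n\ge1$ we have $\mathrm{rank}_{d-1}(S_d)\le2$ and $\|f\|_{U^d}\ge\|f\|_{u^d}\ge\frac14$. 3. There is an absolute constant $c>0$ such that $\|f\|_{U^d}\ge c$ for every power of two $d\ge4$ and every $n\ge1$. Moreover, for each fixed power of two $d\ge4$, $\|f\|_{u^d}\to0$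 as $n\to\infty$; in particular, the inverse conjecture for the $U^d$-norm over $\mathbb{F}_2$ is false for these $d$. -/

import Mathlib

open scoped BigOperators

noncomputable section

/-- The iterated additive derivative `D_{h_1} ⋯ D_{h_k} P`, where `D_h P (x) = P (x + h) - P x`
(Mathlib's `fwdDiff`). -/
def iterAddDeriv {G A : Type*} [AddCommGroup G] [AddCommGroup A] {k : ℕ}
    (h : Fin k → G) (P : G → A) : G → A :=
  (List.ofFn h).foldr fwdDiff P

/-- The multiplicative derivative `Δ_h f (x) = f (x + h) * conj (f x)`. -/
def mulDeriv {G : Type*} [AddCommGroup G] (h : G) (f : G → ℂ) : G → ℂ :=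
  fun x => f (x + h) * (starRingEnd ℂ) (f x)

/-- The iterated multiplicative derivative `Δ_{h_1} ⋯ Δ_{h_k} f`. -/
def iterMulDeriv {G : Type*} [AddCommGroup G] {k : ℕ} (h : Fin k → G) (f : G → ℂ) : G → ℂ :=
  (List.ofFn h).foldr mulDeriv f

/-- `𝒫_d(𝔽_p^n)`: the functions `P : 𝔽_p^n → 𝔽_p` all of whose `(d+1)`-fold additive derivatives
vanish identically. -/
def polyDegLE (p n d : ℕ) : Set ((Fin n → ZMod p) → ZMod p) :=
  {P | ∀ h : Fin (d + 1) → (Fin n → ZMod p), iterAddDeriv h P = 0}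

/-- The degree `d` rank of `P`: the least `k` such that `P = B(Q_1, …, Q_k)` for some
`Q_1, …, Q_k ∈ 𝒫_d` and some function `B : 𝔽_p^k → 𝔽_p`; it is `⊤` if there is no such `k`. -/
def polyRank {p n : ℕ} (d : ℕ) (P : (Fin n → ZMod p) → ZMod p) : ℕ∞ :=
  sInf {r : ℕ∞ | ∃ k : ℕ, r = (k : ℕ∞) ∧
    ∃ Q : Fin k → ((Fin n → ZMod p) → ZMod p), (∀ i, Q i ∈ polyDegLE p n d) ∧
      ∃ B : (Fin k → ZMod p) → ZMod p, ∀ x, P x = B (fun i => Q i x)}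

/-- The Gowers norm `‖f‖_{U^k}` (for `k ≥ 1`). -/
def gowersNorm {G : Type*} [AddCommGroup G] [Fintype G] (k : ℕ) (f : G → ℂ) : ℝ :=
  ‖𝔼 h : Fin k → G, 𝔼 x : G, iterMulDeriv h f x‖ ^ ((1 : ℝ) / 2 ^ k)

/-- The weak Gowers norm `‖f‖_{u^k}` (for `k ≥ 1`): the largest correlation of `f` with a
polynomial phase of degree at most `k - 1`. Here `ZMod.stdAddChar j = exp (2 π i j / p)`. -/
def weakGowersNorm {p n : ℕ} [NeZero p] (k : ℕ) (f : (Fin n → ZMod p) → ℂ) : ℝ :=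
  ⨆ Q : polyDegLE p n (k - 1),
    ‖𝔼 x : Fin n → ZMod p, f x * ZMod.stdAddChar (-(Q : (Fin n → ZMod p) → ZMod p) x)‖

/-- The inverse conjecture for the `U^k`-norm over `𝔽_p` (for `k ≥ 1`); the constant `c` may depend
on `k`, `δ` and `p`, but not on `n` or `f`. -/
def GowersInverseConjecture (p : ℕ) [NeZero p] (k : ℕ) : Prop :=
  ∀ δ : ℝ, 0 < δ → δ ≤ 1 → ∃ c : ℝ, 0 < c ∧
    ∀ (n : ℕ) (f : (Fin n → ZMod p) → ℂ), (∀ x, ‖f x‖ ≤ 1) →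
      δ ≤ gowersNorm k f → c ≤ weakGowersNorm k f

/-- The `d`-th elementary symmetric polynomial `S_d`, as a function `𝔽_p^n → 𝔽_p`. -/
def symmFun (p n d : ℕ) (x : Fin n → ZMod p) : ZMod p :=
  MvPolynomial.eval x (MvPolynomial.esymm (Fin n) (ZMod p) d)

/-- The function `(-1)^{S_d}` on `𝔽_2^n`. -/
def signSymm (n d : ℕ) (x : Fin n → ZMod 2) : ℂ :=
  (-1) ^ (symmFun 2 n d x).val

end

/-! ### Gowers norms: monotonicity and invariance under phases -/

section GowersNorm

open Finset

variable {G : Type*} [AddCommGroup G]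

/-! Over 𝔽₂ the value of `S_d` is the binomial coefficient C(|x|, d) mod 2, where |x| is the Hamming
weight, so Lucas' theorem governs everything.

If d = 2^k + r with 0 < r < 2^k, Lucas gives S_d = S_{2^k} S_r. Expanding (-1)^{ab} in characters of
(a, b) shows that f correlates with one of 0, S_{2^k}, S_r, S_{2^k} + S_r, all of degree below d.

If d = 2^k, both f and e(-|x|/2^{k+1}) change sign when the weight grows by 2^k, so their product
has period 2^k in the weight. Functions of the weight mod 2^k have degree below 2^k
(`degLT_periodic_wt`), and |x| mod 2^{k+1} is a nonclassical polynomial of degree at most k+1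
(`degLT_wt_cast`), which is below 2^k once k ≥ 2. Multiplying by such phases does not change the U^d
norm, and the norm bounds the mean, so a suitable choice of signs gives `half_le_gowersNorm`.

Classical polynomials Q of degree below 2^k nevertheless do not correlate with f. By Ramsey's
theorem there is a large set of coordinates on which all top-degree coefficients of Q agree. With
the other coordinates fixed, the top part of Q is then a function of the weight of period 2^k;
absorbing it keeps the function of the weight antiperiodic and lowers the degree of Q. In degree 0,
the mean of an antiperiodic function of the weight tends to 0 (`exists_norm_sum_mul_stdAddChar_le`).

For d = 1 the function f is balanced; for d = 2 almost all its derivatives have mean zero. -/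

lemma iterMulDeriv_cons {k : ℕ} (a : G) (h : Fin k → G) (f : G → ℂ) :
    iterMulDeriv (Fin.cons a h) f = mulDeriv a (iterMulDeriv h f) := by
  simp [iterMulDeriv, List.ofFn_succ]

lemma mulDeriv_mul (a : G) (f g : G → ℂ) :
    mulDeriv a (f * g) = mulDeriv a f * mulDeriv a g := by
  ext x
  simp only [mulDeriv, Pi.mul_apply, map_mul]
  ring

lemma iterMulDeriv_mul {k : ℕ} (h : Fin k → G) (f g : G → ℂ) :
    iterMulDeriv h (f * g) = iterMulDeriv h f * iterMulDeriv h g := by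
  unfold iterMulDeriv
  induction List.ofFn h with
  | nil => rfl
  | cons a l ih => simp [ih, mulDeriv_mul]

lemma mulDeriv_stdAddChar_comp {N : ℕ} [NeZero N] (a : G) (P : G → ZMod N) :
    mulDeriv a (fun x => ZMod.stdAddChar (P x)) = fun x => ZMod.stdAddChar (fwdDiff a P x) := by
  ext x
  have : starRingEnd ℂ (ZMod.stdAddChar (P x)) = ZMod.stdAddChar (-P x) := by
    rw [AddChar.map_neg_eq_conj]
  rw [mulDeriv, this, ← AddChar.map_add_eq_mul, fwdDiff, sub_eq_add_neg]

lemma iterMulDeriv_stdAddChar_comp {N k : ℕ} [NeZero N] (h : Fin k → G) (P : G → ZMod N) :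
    iterMulDeriv h (fun x => ZMod.stdAddChar (P x)) =
      fun x => ZMod.stdAddChar (iterAddDeriv h P x) := by
  unfold iterMulDeriv iterAddDeriv
  induction List.ofFn h with
  | nil => rfl
  | cons a l ih => simp [ih, mulDeriv_stdAddChar_comp]

variable [Fintype G]

lemma expect_mulDeriv (F : G → ℂ) :
    𝔼 a : G, 𝔼 x : G, mulDeriv a F x = ((‖𝔼 x : G, F x‖ ^ 2 : ℝ) : ℂ) := by
  have : ((‖𝔼 x : G, F x‖ ^ 2 : ℝ) : ℂ) = (𝔼 x : G, F x) * 𝔼 y : G, starRingEnd ℂ (F y) := by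
    rw [← map_expect (starRingEnd ℂ), Complex.mul_conj, Complex.normSq_eq_norm_sq]
  rw [this, expect_comm, mul_comm, expect_mul]
  refine expect_congr rfl fun x _ => ?_
  rw [mul_expect]
  refine Fintype.expect_equiv (Equiv.addLeft x) _ _ fun a => ?_
  simp [mulDeriv, mul_comm]

lemma expect_iterMulDeriv_succ (k : ℕ) (f : G → ℂ) :
    𝔼 h : Fin (k + 1) → G, 𝔼 x : G, iterMulDeriv h f x =
      ((𝔼 h : Fin k → G, ‖𝔼 x : G, iterMulDeriv h f x‖ ^ 2 : ℝ) : ℂ) := by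
  have e : 𝔼 h : Fin (k + 1) → G, 𝔼 x : G, iterMulDeriv h f x =
      𝔼 p : G × (Fin k → G), 𝔼 x : G, mulDeriv p.1 (iterMulDeriv p.2 f) x := by
    symm
    refine Fintype.expect_equiv (Fin.consEquiv fun _ => G) _ _ fun p => ?_
    simp [Fin.consEquiv, iterMulDeriv_cons]
  rw [e, ← univ_product_univ, expect_product, expect_comm]
  simp only [expect_mulDeriv]
  exact (map_expect Complex.ofRealHom _ _).symm

/-- Cauchy–Schwarz over the directions. Iterated from k = 0, it bounds the mean of f by each Gowers
norm. -/
lemma sq_norm_expect_iterMulDeriv_le (k : ℕ) (f : G → ℂ) :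
    ‖𝔼 h : Fin k → G, 𝔼 x : G, iterMulDeriv h f x‖ ^ 2 ≤
      ‖𝔼 h : Fin (k + 1) → G, 𝔼 x : G, iterMulDeriv h f x‖ := by
  rw [expect_iterMulDeriv_succ, Complex.norm_real, Real.norm_of_nonneg
    (expect_nonneg fun _ _ => by positivity)]
  have h1 : ‖𝔼 h : Fin k → G, 𝔼 x : G, iterMulDeriv h f x‖ ≤
      𝔼 h : Fin k → G, ‖𝔼 x : G, iterMulDeriv h f x‖ := RCLike.norm_expect_le (K := ℂ)
  have h2 := expect_mul_sq_le_sq_mul_sq univ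
    (fun h : Fin k → G => ‖𝔼 x : G, iterMulDeriv h f x‖) (fun _ => 1)
  simp only [mul_one, one_pow, expect_const univ_nonempty] at h2
  exact (pow_le_pow_left₀ (norm_nonneg _) h1 2).trans h2

lemma norm_expect_pow_le (k : ℕ) (f : G → ℂ) :
    ‖𝔼 x : G, f x‖ ^ 2 ^ k ≤ ‖𝔼 h : Fin k → G, 𝔼 x : G, iterMulDeriv h f x‖ := by
  induction k with
  | zero => simp [iterMulDeriv]
  | succ k ih =>
    rw [pow_succ, pow_mul]
    exact (pow_le_pow_left₀ (by positivity) ih 2).trans (sq_norm_expect_iterMulDeriv_le k f)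

lemma norm_expect_le_gowersNorm (k : ℕ) (f : G → ℂ) : ‖𝔼 x : G, f x‖ ≤ gowersNorm k f := by
  have h := Real.rpow_le_rpow (by positivity) (norm_expect_pow_le k f)
    (show (0 : ℝ) ≤ 1 / 2 ^ k by positivity)
  rwa [← Real.rpow_natCast, ← Real.rpow_mul (norm_nonneg _), Nat.cast_pow, Nat.cast_two,
    mul_one_div_cancel (by positivity), Real.rpow_one] at h

/-- Phases annihilated by all `k`-fold derivatives correlate with `f` at most `‖f‖_{U^k}`. -/
lemma norm_expect_mul_le_gowersNorm (k : ℕ) (f g : G → ℂ)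
    (hg : ∀ h : Fin k → G, iterMulDeriv h g = 1) : ‖𝔼 x : G, f x * g x‖ ≤ gowersNorm k f := by
  have h := norm_expect_le_gowersNorm k (f * g)
  simpa only [gowersNorm, iterMulDeriv_mul, hg, Pi.one_apply, mul_one, Pi.mul_apply] using h

lemma gowersNorm_nonneg (k : ℕ) (f : G → ℂ) : 0 ≤ gowersNorm k f := by
  unfold gowersNorm; positivity

end GowersNorm

/-! ### Polynomial degree through vanishing derivatives -/

section Degree

variable {G A : Type*} [AddCommGroup G]

/-- All `k`-fold additive derivatives of `P` vanish. -/
def DegLT [AddCommGroup A] (k : ℕ) (P : G → A) : Prop :=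
  ∀ l : List G, k ≤ l.length → l.foldr fwdDiff P = 0

lemma foldr_fwdDiff_zero [AddCommGroup A] (l : List G) :
    l.foldr fwdDiff (0 : G → A) = 0 := by
  induction l with
  | nil => rfl
  | cons a l ih => ext x; simp [ih, fwdDiff]

lemma foldr_fwdDiff_add [AddCommGroup A] (l : List G) (P Q : G → A) :
    l.foldr fwdDiff (P + Q) = l.foldr fwdDiff P + l.foldr fwdDiff Q := by
  induction l with
  | nil => rfl
  | cons a l ih => simp [ih]

lemma degLT_iff [AddCommGroup A] {k : ℕ} {P : G → A} :
    DegLT k P ↔ ∀ h : Fin k → G, iterAddDeriv h P = 0 := by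
  constructor
  · intro H h
    exact H _ (by simp)
  · intro H l hl
    -- The fold differentiates along the last entries first, so the final k directions already give
    -- 0.
    rw [← List.take_append_drop (l.length - k) l, List.foldr_append]
    have h1 : (l.drop (l.length - k)).length = k := by simp; omega
    have h2 : (l.drop (l.length - k)).foldr fwdDiff P = 0 := by
      have := H (fun i => (l.drop (l.length - k)).get (i.cast h1.symm))
      rw [iterAddDeriv] at this
      convert this
      apply List.ext_get <;> simp [h1]
    rw [h2, foldr_fwdDiff_zero]

lemma mem_polyDegLE_iff {p n d : ℕ} {P : (Fin n → ZMod p) → ZMod p} :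
    P ∈ polyDegLE p n d ↔ DegLT (d + 1) P := degLT_iff.symm

lemma DegLT.mono [AddCommGroup A] {k m : ℕ} {P : G → A} (h : DegLT k P) (hm : k ≤ m) :
    DegLT m P := fun l hl => h l (hm.trans hl)

lemma degLT_zero [AddCommGroup A] (k : ℕ) : DegLT k (0 : G → A) :=
  fun l _ => foldr_fwdDiff_zero l

lemma DegLT.add [AddCommGroup A] {k : ℕ} {P Q : G → A} (hP : DegLT k P) (hQ : DegLT k Q) :
    DegLT k (P + Q) := fun l hl => by rw [foldr_fwdDiff_add, hP l hl, hQ l hl, add_zero]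

lemma DegLT.sum [AddCommGroup A] {ι : Type*} {k : ℕ} (s : Finset ι) {P : ι → G → A}
    (hP : ∀ i ∈ s, DegLT k (P i)) : DegLT k (∑ i ∈ s, P i) := by
  classical
  induction s using Finset.induction_on with
  | empty => simpa using degLT_zero k
  | insert a s ha ih =>
    rw [Finset.sum_insert ha]
    exact (hP a (by simp)).add (ih fun i hi => hP i (by simp [hi]))

lemma degLT_zero_iff [AddCommGroup A] {P : G → A} : DegLT 0 P ↔ P = 0 :=
  ⟨fun h => h [] le_rfl, fun h => h ▸ degLT_zero 0⟩

lemma degLT_succ_iff [AddCommGroup A] {k : ℕ} {P : G → A} :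
    DegLT (k + 1) P ↔ ∀ h, DegLT k (fwdDiff h P) := by
  constructor
  · intro H h l hl
    simpa using H (l ++ [h]) (by simpa using hl)
  · intro H l hl
    obtain ⟨l', a, rfl⟩ : ∃ l' a, l = l' ++ [a] := by
      rcases List.eq_nil_or_concat l with rfl | ⟨l', a, h⟩
      · simp at hl
      · exact ⟨l', a, by simpa using h⟩
    simpa using H a l' (by simpa using hl)

lemma degLT_one_const [AddCommGroup A] (a : A) : DegLT 1 (fun _ : G => a) :=
  degLT_succ_iff.2 fun h => degLT_zero_iff.2 (by ext; simp)

lemma DegLT.translate [AddCommGroup A] {k : ℕ} (t : G) {P : G → A} (hP : DegLT k P) :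
    DegLT k (fun x => P (x + t)) := by
  induction k generalizing P with
  | zero =>
    rw [degLT_zero_iff] at hP ⊢
    subst hP; rfl
  | succ k ih =>
    rw [degLT_succ_iff] at hP ⊢
    intro h
    convert ih (hP h) using 2 with x
    simp [fwdDiff, add_right_comm]

lemma DegLT.mul [CommRing A] {a b : ℕ} {P Q : G → A} (hP : DegLT (a + 1) P)
    (hQ : DegLT (b + 1) Q) : DegLT (a + b + 1) (P * Q) := by
  induction hn : a + b generalizing a b P Q with
  | zero =>
    obtain ⟨rfl, rfl⟩ : a = 0 ∧ b = 0 := by omega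
    rw [degLT_succ_iff] at *
    intro h
    have h1 := degLT_zero_iff.1 (hP h)
    have h2 := degLT_zero_iff.1 (hQ h)
    rw [degLT_zero_iff]
    ext x
    have h1 := congrFun h1 x
    have h2 := congrFun h2 x
    simp only [fwdDiff, Pi.zero_apply, sub_eq_zero] at h1 h2
    simp [fwdDiff, h1, h2]
  | succ n ih =>
    rw [degLT_succ_iff]
    intro h
    have e : fwdDiff h (P * Q) = (fun x => P (x + h)) * fwdDiff h Q + fwdDiff h P * Q := by
      ext x; simp only [fwdDiff, Pi.mul_apply, Pi.add_apply]; ring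
    rw [e]
    apply DegLT.add
    · rcases b with _ | b
      · rw [degLT_zero_iff.1 (degLT_succ_iff.1 hQ h), mul_zero]; exact degLT_zero _
      · exact ih (hP.translate h) (degLT_succ_iff.1 hQ h) (by omega)
    · rcases a with _ | a
      · rw [degLT_zero_iff.1 (degLT_succ_iff.1 hP h), zero_mul]; exact degLT_zero _
      · exact ih (degLT_succ_iff.1 hP h) hQ (by omega)

lemma DegLT.prod [CommRing A] {ι : Type*} (s : Finset ι) {P : ι → G → A}
    (hP : ∀ i ∈ s, DegLT 2 (P i)) : DegLT (s.card + 1) (∏ i ∈ s, P i) := by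
  classical
  induction s using Finset.induction_on with
  | empty => exact degLT_one_const (1 : A)
  | insert a s ha ih =>
    rw [Finset.prod_insert ha, Finset.card_insert_of_notMem ha]
    exact ((hP a (by simp)).mul (ih fun i hi => hP i (by simp [hi]))).mono (by omega)

lemma DegLT.const_mul [CommRing A] {k : ℕ} (a : A) {P : G → A} (hP : DegLT k P) :
    DegLT k (fun x => a * P x) := by
  rcases k with _ | k
  · rw [degLT_zero_iff] at *; subst hP; ext; simp
  · exact ((degLT_one_const a).mul hP).mono (by omega)

lemma degLT_two_proj {n p : ℕ} (i : Fin n) : DegLT 2 (fun x : Fin n → ZMod p => x i) := by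
  refine degLT_succ_iff.2 fun h => ?_
  convert degLT_one_const (G := Fin n → ZMod p) (h i) using 2 with x
  simp [fwdDiff]

lemma symmFun_eq_sum (p n d : ℕ) : symmFun p n d =
    ∑ s ∈ Finset.powersetCard d Finset.univ, ∏ i ∈ s, fun x : Fin n → ZMod p => x i := by
  ext x
  simp [symmFun, MvPolynomial.esymm]

lemma degLT_symmFun (p n d : ℕ) : DegLT (d + 1) (symmFun p n d) := by
  rw [symmFun_eq_sum]
  refine DegLT.sum _ fun s hs => ?_
  rw [Finset.mem_powersetCard] at hs
  rw [← hs.2]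
  exact DegLT.prod _ fun i _ => degLT_two_proj i

end Degree
-- Binomial coefficients modulo 2
section Binomial

lemma choose_cast_two (m j : ℕ) :
    ((m.choose j : ℕ) : ZMod 2) = ((m % 2).choose (j % 2) : ℕ) * ((m / 2).choose (j / 2) : ℕ) := by
  rw [← Nat.cast_mul, ZMod.natCast_eq_natCast_iff]
  exact Choose.choose_modEq_choose_mod_mul_choose_div_nat

/-- By Lucas the coefficient factors over binary digits, and 2^k and r have no common digit. -/
lemma choose_two_pow_add (k m r : ℕ) (hr : r < 2 ^ k) :
    ((m.choose (2 ^ k + r) : ℕ) : ZMod 2) = (m.choose (2 ^ k) : ℕ) * (m.choose r : ℕ) := by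
  induction k generalizing m r with
  | zero =>
    obtain rfl : r = 0 := by simpa using hr
    simp
  | succ k ih =>
    rw [choose_cast_two m (2 ^ (k + 1) + r), choose_cast_two m (2 ^ (k + 1)), choose_cast_two m r]
    have h1 : (2 ^ (k + 1) + r) % 2 = r % 2 := by omega
    have h2 : (2 ^ (k + 1) + r) / 2 = 2 ^ k + r / 2 := by omega
    have h3 : 2 ^ (k + 1) % 2 = 0 := by omega
    have h4 : 2 ^ (k + 1) / 2 = 2 ^ k := by omega
    rw [h1, h2, h3, h4, ih _ _ (by omega)]
    simp
    ring

lemma choose_add_two_pow (k m j : ℕ) (hj : j < 2 ^ k) :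
    (((m + 2 ^ k).choose j : ℕ) : ZMod 2) = (m.choose j : ℕ) := by
  induction k generalizing m j with
  | zero =>
    obtain rfl : j = 0 := by simpa using hj
    simp
  | succ k ih =>
    rw [choose_cast_two, choose_cast_two m j]
    have h1 : (m + 2 ^ (k + 1)) % 2 = m % 2 := by omega
    have h2 : (m + 2 ^ (k + 1)) / 2 = m / 2 + 2 ^ k := by omega
    rw [h1, h2, ih _ _ (by omega)]

lemma choose_add_two_pow_self (k m : ℕ) :
    (((m + 2 ^ k).choose (2 ^ k) : ℕ) : ZMod 2) = (m.choose (2 ^ k) : ℕ) + 1 := by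
  induction k generalizing m with
  | zero => simp
  | succ k ih =>
    rw [choose_cast_two, choose_cast_two m]
    have h1 : (m + 2 ^ (k + 1)) % 2 = m % 2 := by omega
    have h2 : (m + 2 ^ (k + 1)) / 2 = m / 2 + 2 ^ k := by omega
    have h3 : 2 ^ (k + 1) % 2 = 0 := by omega
    have h4 : 2 ^ (k + 1) / 2 = 2 ^ k := by omega
    rw [h1, h2, h3, h4, ih]
    simp

end Binomial

/-! ### Symmetric functions through the Hamming weight -/

section Weight

open Finset

/-- The Hamming weight of a vector. -/
def wt {n : ℕ} (x : Fin n → ZMod 2) : ℕ := #{i | x i ≠ 0}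

lemma symmFun_eq_choose (n d : ℕ) (x : Fin n → ZMod 2) :
    symmFun 2 n d x = ((wt x).choose d : ℕ) := by
  have h : ∀ s : Finset (Fin n), ∏ i ∈ s, x i = if s ⊆ ({i | x i ≠ 0} : Finset (Fin n)) then 1 else 0 := by
    intro s
    split_ifs with hs
    · refine prod_eq_one fun i hi => ?_
      have : x i ≠ 0 := by simpa using hs hi
      revert this
      generalize x i = a
      revert a
      decide
    · obtain ⟨i, hi, h⟩ := not_subset.1 hs
      exact prod_eq_zero hi (by simpa using h)
  simp only [symmFun_eq_sum, Finset.sum_apply, Finset.prod_apply, h]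
  rw [sum_boole, wt, ← card_powersetCard]
  congr 2
  ext s
  simp [mem_powersetCard, and_comm]

/-- The sign `(-1)^a` for `a : 𝔽_2`. -/
lemma stdAddChar_two (a : ZMod 2) : (ZMod.stdAddChar a : ℂ) = (-1) ^ a.val := by
  obtain rfl | rfl : a = 0 ∨ a = 1 := by revert a; decide
  · simp
  · have := ZMod.stdAddChar_coe (N := 2) 1
    simp only [Int.cast_one, Nat.cast_ofNat, mul_one] at this
    rw [this, ZMod.val_one, pow_one, ← Complex.exp_pi_mul_I]
    congr 1
    ring

lemma signSymm_eq (n d : ℕ) (x : Fin n → ZMod 2) :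
    signSymm n d x = ZMod.stdAddChar (symmFun 2 n d x) := (stdAddChar_two _).symm

lemma bddAbove_weakGowersNorm {n : ℕ} (k : ℕ) (f : (Fin n → ZMod 2) → ℂ) :
    BddAbove (Set.range fun Q : polyDegLE 2 n (k - 1) =>
      ‖𝔼 x : Fin n → ZMod 2, f x *
        ZMod.stdAddChar (-(Q : (Fin n → ZMod 2) → ZMod 2) x)‖) :=
  (Set.finite_range _).bddAbove

lemma weakGowersNorm_nonneg {n : ℕ} (k : ℕ) (f : (Fin n → ZMod 2) → ℂ) :
    0 ≤ weakGowersNorm k f := Real.iSup_nonneg fun _ => norm_nonneg _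

lemma iterMulDeriv_stdAddChar_eq_one {G : Type*} [AddCommGroup G] {N k : ℕ} [NeZero N]
    {P : G → ZMod N} (hP : DegLT k P) (h : Fin k → G) :
    iterMulDeriv h (fun x => ZMod.stdAddChar (P x)) = 1 := by
  rw [iterMulDeriv_stdAddChar_comp, degLT_iff.1 hP h]
  ext; simp

lemma DegLT.neg {G A : Type*} [AddCommGroup G] [CommRing A] {k : ℕ} {P : G → A}
    (hP : DegLT k P) : DegLT k (fun x => -P x) := by
  simpa using hP.const_mul (-1)

lemma weakGowersNorm_le_gowersNorm {n : ℕ} (k : ℕ) (hk : 1 ≤ k) (f : (Fin n → ZMod 2) → ℂ) :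
    weakGowersNorm k f ≤ gowersNorm k f := by
  refine Real.iSup_le (fun Q => ?_) (gowersNorm_nonneg k f)
  have hQ := mem_polyDegLE_iff.1 Q.2
  rw [Nat.sub_add_cancel hk] at hQ
  exact norm_expect_mul_le_gowersNorm k f _ (iterMulDeriv_stdAddChar_eq_one hQ.neg)

end Weight

/-! ### Degrees that are not powers of two -/

section NotPowerOfTwo

open Finset

lemma exists_two_pow_add (d : ℕ) (hd : 1 ≤ d) (h : ¬ ∃ j : ℕ, d = 2 ^ j) :
    ∃ k r, 0 < r ∧ r < 2 ^ k ∧ d = 2 ^ k + r := by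
  have h1 := Nat.pow_log_le_self 2 (show d ≠ 0 by omega)
  have h2 := Nat.lt_pow_succ_log_self (b := 2) (by norm_num) d
  have h3 : d ≠ 2 ^ Nat.log 2 d := fun e => h ⟨_, e⟩
  rw [pow_succ] at h2
  exact ⟨Nat.log 2 d, d - 2 ^ Nat.log 2 d, by omega, by omega, by omega⟩

lemma symmFun_two_pow_add (n k r : ℕ) (hr : r < 2 ^ k) (x : Fin n → ZMod 2) :
    symmFun 2 n (2 ^ k + r) x = symmFun 2 n (2 ^ k) x * symmFun 2 n r x := by
  simp only [symmFun_eq_choose, choose_two_pow_add k _ r hr]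

lemma symmFun_mem_polyDegLE {n j d : ℕ} (h : j ≤ d) : symmFun 2 n j ∈ polyDegLE 2 n d :=
  mem_polyDegLE_iff.2 ((degLT_symmFun 2 n j).mono (by omega))

lemma polyRank_symmFun_le {n d : ℕ} (hd : 1 ≤ d) (h : ¬ ∃ j : ℕ, d = 2 ^ j) :
    polyRank (d - 1) (symmFun 2 n d) ≤ 2 := by
  obtain ⟨k, r, h0, hr, rfl⟩ := exists_two_pow_add d hd h
  have := Nat.two_pow_pos k
  refine sInf_le ⟨2, rfl, ![symmFun 2 n (2 ^ k), symmFun 2 n r], ?_, fun y => y 0 * y 1, ?_⟩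
  · intro i
    fin_cases i <;> exact symmFun_mem_polyDegLE (by omega)
  · intro x
    simp [symmFun_two_pow_add n k r hr]

/-- This is (-1)^{ab} times its own Fourier expansion (1 + (-1)^a + (-1)^b - (-1)^{a+b})/2. -/
lemma stdAddChar_two_mul (a b : ZMod 2) : (1 : ℂ) =
    (ZMod.stdAddChar (a * b) * ZMod.stdAddChar (-0 : ZMod 2) + ZMod.stdAddChar (a * b) * ZMod.stdAddChar (-a)
      + ZMod.stdAddChar (a * b) * ZMod.stdAddChar (-b)
      - ZMod.stdAddChar (a * b) * ZMod.stdAddChar (-(a + b))) / 2 := by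
  have h (c d : ZMod 2) : (ZMod.stdAddChar c * ZMod.stdAddChar d : ℂ) = (-1) ^ (c + d).val := by
    rw [← AddChar.map_add_eq_mul, stdAddChar_two]
  simp only [h]
  have key : ∀ a b : ZMod 2, (2 : ℤ) = (-1) ^ (a * b + -0).val + (-1) ^ (a * b + -a).val +
    (-1) ^ (a * b + -b).val - (-1) ^ (a * b + -(a + b)).val := by decide
  rw [eq_div_iff two_ne_zero, one_mul]
  exact_mod_cast key a b

lemma quarter_le_weakGowersNorm {n d : ℕ} (hd : 1 ≤ d) (h : ¬ ∃ j : ℕ, d = 2 ^ j) :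
    1 / 4 ≤ weakGowersNorm d (signSymm n d) := by
  obtain ⟨k, r, h0, hr, rfl⟩ := exists_two_pow_add d hd h
  have := Nat.two_pow_pos k
  set S := symmFun 2 n (2 ^ k)
  set R := symmFun 2 n r
  set f := signSymm n (2 ^ k + r) with hf
  set w := weakGowersNorm (2 ^ k + r) f
  have hS : S ∈ polyDegLE 2 n (2 ^ k + r - 1) := symmFun_mem_polyDegLE (by omega)
  have hR : R ∈ polyDegLE 2 n (2 ^ k + r - 1) := symmFun_mem_polyDegLE (by omega)
  have hw (Q : (Fin n → ZMod 2) → ZMod 2) (hQ : Q ∈ polyDegLE 2 n (2 ^ k + r - 1)) :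
      ‖𝔼 x, f x * ZMod.stdAddChar (-Q x)‖ ≤ w :=
    le_ciSup (bddAbove_weakGowersNorm (2 ^ k + r) f) ⟨Q, hQ⟩
  have e0 := hw 0 (mem_polyDegLE_iff.2 (degLT_zero _))
  have e1 := hw S hS
  have e2 := hw R hR
  have e3 := hw (S + R) (mem_polyDegLE_iff.2 ((mem_polyDegLE_iff.1 hS).add (mem_polyDegLE_iff.1 hR)))
  have key : (1 : ℂ) = (𝔼 x, f x * ZMod.stdAddChar (-(0 : (Fin n → ZMod 2) → ZMod 2) x)
      + 𝔼 x, f x * ZMod.stdAddChar (-S x) + 𝔼 x, f x * ZMod.stdAddChar (-R x)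
      - 𝔼 x, f x * ZMod.stdAddChar (-(S + R) x)) / 2 := by
    rw [← expect_add_distrib, ← expect_add_distrib, ← expect_sub_distrib, expect_div]
    conv_lhs => rw [← Fintype.expect_const (ι := Fin n → ZMod 2) (1 : ℂ)]
    refine expect_congr rfl fun x _ => ?_
    rw [hf, signSymm_eq, symmFun_two_pow_add n k r hr]
    exact stdAddChar_two_mul (S x) (R x)
  have hn := congrArg norm key
  -- Four means, each at most `w` in norm, have signed sum 2; this even forces `w` ≥ 1/2.
  rw [norm_one, norm_div, Complex.norm_two] at hn
  have t1 := norm_sub_le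
    (𝔼 x, f x * ZMod.stdAddChar (-(0 : (Fin n → ZMod 2) → ZMod 2) x)
      + 𝔼 x, f x * ZMod.stdAddChar (-S x) + 𝔼 x, f x * ZMod.stdAddChar (-R x))
    (𝔼 x, f x * ZMod.stdAddChar (-(S + R) x))
  have t2 := norm_add₃_le
    (a := 𝔼 x, f x * ZMod.stdAddChar (-(0 : (Fin n → ZMod 2) → ZMod 2) x))
    (b := 𝔼 x, f x * ZMod.stdAddChar (-S x)) (c := 𝔼 x, f x * ZMod.stdAddChar (-R x))
  linarith

end NotPowerOfTwo
-- Degree of functions of the weight, classical and nonclassical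
section PeriodicWeight

open Finset

/-- The interior entries of row 2^k of Pascal's triangle are even, so the 2^k-th difference is Q(m +
2^k) - Q(m). -/
lemma fwdDiff_iter_eq_zero_of_periodic {k : ℕ} {Q : ℕ → ZMod 2} (hQ : ∀ m, Q (m + 2 ^ k) = Q m)
    {j : ℕ} (hj : 2 ^ k ≤ j) (m : ℕ) : (fwdDiff 1)^[j] Q m = 0 := by
  obtain ⟨i, rfl⟩ := Nat.exists_eq_add_of_le hj
  rw [add_comm, Function.iterate_add_apply]
  have h : (fwdDiff 1)^[2 ^ k] Q = fun _ => 0 := by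
    ext m
    rw [fwdDiff_iter_eq_sum_shift, sum_range_succ, ← Nat.succ_pred_eq_of_pos (Nat.two_pow_pos k),
      sum_range_succ', sum_eq_zero]
    · have h2 : (-1 : ℤ) ^ (2 ^ k) • Q m + Q m = 0 := by
        generalize Q m = a
        rcases neg_one_pow_eq_or ℤ (2 ^ k) with h | h <;> rw [h] <;> revert a <;> decide
      rw [Nat.succ_pred_eq_of_pos (Nat.two_pow_pos k)]
      simpa [hQ] using h2
    · intro i hi
      rw [mem_range] at hi
      have : ((((2 ^ k).choose (i + 1) : ℕ) : ℤ) : ZMod 2) = 0 := by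
        have hp := Nat.succ_pred_eq_of_pos (Nat.two_pow_pos k)
        have := choose_add_two_pow k 0 (i + 1) (by omega)
        rw [zero_add] at this
        simpa using this
      rw [Nat.succ_pred_eq_of_pos (Nat.two_pow_pos k), zsmul_eq_mul, Int.cast_mul, this]
      simp
  rw [h]
  clear h
  induction i with
  | zero => rfl
  | succ i ih => rw [Function.iterate_succ_apply]; simpa using ih (by omega)

/-- A function of the weight modulo `2 ^ k` has degree less than `2 ^ k`. -/
lemma degLT_periodic_wt {k n : ℕ} {Q : ℕ → ZMod 2} (hQ : ∀ m, Q (m + 2 ^ k) = Q m) :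
    DegLT (2 ^ k) (fun x : Fin n → ZMod 2 => Q (wt x)) := by
  -- Newton's expansion, cut off at 2^k by periodicity; its terms are multiples of `S_j` with j <
  -- 2^k.
  have key (m : ℕ) : Q m = ∑ j ∈ range (2 ^ k), (fwdDiff 1)^[j] Q 0 * (m.choose j : ℕ) := by
    have hp := Nat.two_pow_pos k
    have h := shift_eq_sum_fwdDiff_iter (1 : ℕ) Q m 0
    rw [zero_add, smul_eq_mul, mul_one] at h
    rw [h, sum_subset (s₂ := range (m + 1 + 2 ^ k)), ← sum_subset (s₁ := range (2 ^ k))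
      (s₂ := range (m + 1 + 2 ^ k))]
    · exact sum_congr rfl fun j _ => by rw [nsmul_eq_mul, mul_comm]
    · exact range_subset_range.2 (by omega)
    · intro j _ hj
      rw [fwdDiff_iter_eq_zero_of_periodic hQ (by simpa using hj), smul_zero]
    · exact range_subset_range.2 (by omega)
    · intro j _ hj
      rw [Nat.choose_eq_zero_of_lt (by simpa [Nat.lt_succ_iff] using hj), zero_smul]
  have : (fun x : Fin n → ZMod 2 => Q (wt x)) =
      ∑ j ∈ range (2 ^ k), fun x => (fwdDiff 1)^[j] Q 0 * symmFun 2 n j x := by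
    ext x
    simp only [key (wt x), Finset.sum_apply, symmFun_eq_choose]
  rw [this]
  exact DegLT.sum _ fun j hj => ((degLT_symmFun 2 n j).mono (by simpa using hj)).const_mul _

/-- Differencing kills q in an even direction and multiplies it by -2 in an odd one, so each
derivative gains a factor 2. -/
lemma foldr_fwdDiff_of_sign {G A : Type*} [AddCommGroup G] [CommRing A] {q : G → A}
    (hq : ∀ h, (∀ x, q (x + h) = q x) ∨ (∀ x, q (x + h) = -q x)) (l : List G) :
    ∃ a : A, ∀ x, l.foldr fwdDiff q x = 2 ^ l.length * a * q x := by
  induction l with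
  | nil => exact ⟨1, by simp⟩
  | cons h l ih =>
    obtain ⟨a, ha⟩ := ih
    rcases hq h with hh | hh
    · exact ⟨0, fun x => by simp [fwdDiff, ha, hh]⟩
    · exact ⟨-a, fun x => by simp only [List.foldr_cons, fwdDiff, ha, hh, List.length_cons]; ring⟩

lemma wt_cast {n : ℕ} {A : Type*} [CommRing A] (x : Fin n → ZMod 2) :
    (wt x : A) = ∑ i, ((x i).val : A) := by
  rw [wt, card_filter, Nat.cast_sum]
  refine sum_congr rfl fun i _ => ?_
  generalize x i = a
  obtain rfl | rfl : a = 0 ∨ a = 1 := by revert a; decide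
  · simp
  · simp [ZMod.val_one]

/-- The weight modulo `2 ^ m` is a nonclassical polynomial of degree at most `m`. -/
lemma degLT_wt_cast (n m : ℕ) :
    DegLT (m + 1) (fun x : Fin n → ZMod 2 => (wt x : ZMod (2 ^ m))) := by
  have e : (fun x : Fin n → ZMod 2 => (wt x : ZMod (2 ^ m))) =
      ∑ i, fun x => ((x i).val : ZMod (2 ^ m)) := by
    ext x; simp [wt_cast]
  rw [e]
  refine DegLT.sum _ fun i _ => degLT_succ_iff.2 fun h => ?_
  have two (a : ZMod 2) : a = 0 ∨ a = 1 := by revert a; decide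
  have hv (a : ZMod 2) : ((a + 1).val : ZMod (2 ^ m)) = 1 - (a.val : ZMod (2 ^ m)) := by
    rcases two a with rfl | rfl
    · simp [ZMod.val_one]
    · simp [ZMod.val_one, CharTwo.add_self_eq_zero]
  rcases two (h i) with hi | hi
  · convert degLT_zero m using 1
    ext x; simp [fwdDiff, hi]
  -- Here the first derivative of the coordinate is 1 - 2x_i, odd under flipping x_i; m further
  -- derivatives produce the factor 2^m = 0.
  · intro l hl
    obtain ⟨a, ha⟩ := foldr_fwdDiff_of_sign
      (q := fwdDiff h fun x : Fin n → ZMod 2 => ((x i).val : ZMod (2 ^ m))) (fun t => by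
        rcases two (t i) with ht | ht
        · left; intro x; simp [fwdDiff, ht]
        · right; intro x; simp only [fwdDiff, Pi.add_apply, ht, hi, hv]; ring) l
    ext x
    have h2 : (2 : ZMod (2 ^ m)) ^ l.length = 0 := by
      obtain ⟨c, hc⟩ := Nat.exists_eq_add_of_le hl
      have := ZMod.natCast_self (2 ^ m)
      rw [hc, pow_add]
      push_cast at this
      rw [this, zero_mul]
    rw [ha, h2]; simp

end PeriodicWeight

/-! ### Lower bound for the Gowers norm when d = 2^k, k ≥ 2 -/

section PowerOfTwo

open Finset

/-- `(-1)^{C(m, 2^k)} e(-m / 2^{k+1})`, a function of period `2^k`. -/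
noncomputable def twist (k m : ℕ) : ℂ :=
  ZMod.stdAddChar ((m.choose (2 ^ k) : ℕ) : ZMod 2) * ZMod.stdAddChar (-(m : ZMod (2 ^ (k + 1))))

lemma twist_periodic (k m : ℕ) : twist k (m + 2 ^ k) = twist k m := by
  have h1 : (ZMod.stdAddChar (1 : ZMod 2) : ℂ) = -1 := by simp [stdAddChar_two, ZMod.val_one]
  have h2 : (ZMod.stdAddChar (-((2 ^ k : ℕ) : ZMod (2 ^ (k + 1)))) : ℂ) = -1 := by
    have := ZMod.stdAddChar_coe (N := 2 ^ (k + 1)) (-(2 ^ k : ℕ))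
    rw [Int.cast_neg, Int.cast_natCast] at this
    rw [this, ← Complex.exp_neg_pi_mul_I]
    congr 1
    push_cast
    field_simp
    ring
  rw [twist, twist, choose_add_two_pow_self, Nat.cast_add, neg_add, AddChar.map_add_eq_mul,
    AddChar.map_add_eq_mul, h1, h2]
  ring

lemma norm_twist (k m : ℕ) : ‖twist k m‖ = 1 := by
  simp [twist, AddChar.norm_apply]

/-- This is where k ≥ 2 is essential: the weight mod 2^{k+1} needs k + 2 derivatives to vanish, and
only 2^k are available. -/
lemma add_two_le_two_pow {k : ℕ} (hk : 2 ≤ k) : k + 2 ≤ 2 ^ k := by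
  induction k, hk using Nat.le_induction with
  | base => norm_num
  | succ k _ ih => rw [pow_succ]; omega

lemma norm_expect_twist_mul_le {k n : ℕ} (hk : 2 ≤ k) {Q : ℕ → ZMod 2}
    (hQ : ∀ m, Q (m + 2 ^ k) = Q m) :
    ‖𝔼 x : Fin n → ZMod 2, ZMod.stdAddChar (Q (wt x)) * twist k (wt x)‖ ≤
      gowersNorm (2 ^ k) (signSymm n (2 ^ k)) := by
  have h := norm_expect_mul_le_gowersNorm (2 ^ k) (signSymm n (2 ^ k))
    ((fun x => ZMod.stdAddChar (Q (wt x))) *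
      fun x => ZMod.stdAddChar (-(wt x : ZMod (2 ^ (k + 1))))) (fun h => by
      rw [iterMulDeriv_mul, iterMulDeriv_stdAddChar_eq_one (degLT_periodic_wt hQ),
        iterMulDeriv_stdAddChar_eq_one
          ((degLT_wt_cast n (k + 1)).neg.mono (add_two_le_two_pow hk)), mul_one])
  refine le_trans (le_of_eq (congrArg norm ?_)) h
  refine expect_congr rfl fun x _ => ?_
  rw [signSymm_eq, symmFun_eq_choose, twist, Pi.mul_apply]
  ring

/-- If `L` is `Re` or `Im`, the mean of `|L (twist k)|` is at most the Gowers norm. -/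
lemma expect_abs_le_gowersNorm {k n : ℕ} (hk : 2 ≤ k) (L : ℂ →ₗ[ℝ] ℝ)
    (hL : ∀ z, |L z| ≤ ‖z‖) :
    𝔼 x : Fin n → ZMod 2, |L (twist k (wt x))| ≤ gowersNorm (2 ^ k) (signSymm n (2 ^ k)) := by
  -- Q records the sign of `L (twist k m)`; it inherits the period 2^k, so it is an admissible
  -- phase.
  refine le_trans ?_ (norm_expect_twist_mul_le (n := n) hk
    (Q := fun m => if L (twist k m) < 0 then 1 else 0) (fun m => by rw [twist_periodic]))
  refine le_trans (le_of_eq ?_) ((le_abs_self _).trans (hL _))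
  have : L (𝔼 x : Fin n → ZMod 2, ZMod.stdAddChar (if L (twist k (wt x)) < 0 then (1 : ZMod 2) else 0)
      * twist k (wt x)) = 𝔼 x : Fin n → ZMod 2,
      L (ZMod.stdAddChar (if L (twist k (wt x)) < 0 then (1 : ZMod 2) else 0) * twist k (wt x)) :=
    map_expect (L.restrictScalars ℚ≥0 : ℂ →ₗ[ℚ≥0] ℝ) _ _
  rw [this]
  refine expect_congr rfl fun x _ => ?_
  split_ifs with h
  · simp [stdAddChar_two, ZMod.val_one, abs_of_neg h]
  · simp [abs_of_nonneg (not_lt.1 h)]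

/-- Since |Re z| + |Im z| ≥ |z| = 1 for every value of the twist, the two means add up to at least
1. -/
lemma half_le_gowersNorm {k n : ℕ} (hk : 2 ≤ k) :
    1 / 2 ≤ gowersNorm (2 ^ k) (signSymm n (2 ^ k)) := by
  have h1 := expect_abs_le_gowersNorm (n := n) hk Complex.reLm Complex.abs_re_le_norm
  have h2 := expect_abs_le_gowersNorm (n := n) hk Complex.imLm Complex.abs_im_le_norm
  have h3 : (1 : ℝ) ≤ 𝔼 x : Fin n → ZMod 2,
      (|Complex.reLm (twist k (wt x))| + |Complex.imLm (twist k (wt x))|) := by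
    conv_lhs => rw [← Fintype.expect_const (ι := Fin n → ZMod 2) (1 : ℝ)]
    refine expect_le_expect fun x _ => ?_
    rw [← norm_twist k (wt x)]
    exact Complex.norm_le_abs_re_add_abs_im _
  rw [expect_add_distrib] at h3
  linarith

end PowerOfTwo
-- Hypergraph Ramsey theorem
section Ramsey

open Finset

/-- The finite hypergraph Ramsey theorem for two colours. -/
theorem exists_homogeneous_subset (r p q : ℕ) : ∃ N : ℕ, ∀ {ι : Type} [DecidableEq ι]
    (V : Finset ι), N ≤ #V → ∀ c : Finset ι → Prop,
      (∃ W ⊆ V, #W = p ∧ ∀ S ⊆ W, #S = r → c S) ∨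
      (∃ W ⊆ V, #W = q ∧ ∀ S ⊆ W, #S = r → ¬ c S) := by
  induction r generalizing p q with
  | zero =>
    refine ⟨max p q, fun V hV c => ?_⟩
    by_cases h : c ∅
    · obtain ⟨W, hW, hp⟩ := exists_subset_card_eq ((le_max_left p q).trans hV)
      exact .inl ⟨W, hW, hp, fun S _ hS => by rwa [card_eq_zero.1 hS]⟩
    · obtain ⟨W, hW, hp⟩ := exists_subset_card_eq ((le_max_right p q).trans hV)
      exact .inr ⟨W, hW, hp, fun S _ hS => by rwa [card_eq_zero.1 hS]⟩
  | succ r ih =>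
    induction p generalizing q with
    | zero =>
      refine ⟨0, fun V _ c => .inl ⟨∅, empty_subset _, rfl, fun S hS h => ?_⟩⟩
      simp [subset_empty.1 hS] at h
    | succ p ihp =>
      induction q with
      | zero =>
        refine ⟨0, fun V _ c => .inr ⟨∅, empty_subset _, rfl, fun S hS h => ?_⟩⟩
        simp [subset_empty.1 hS] at h
      | succ q ihq =>
        obtain ⟨N₁, h₁⟩ := ihp (q + 1)
        obtain ⟨N₂, h₂⟩ := ihq
        obtain ⟨N, h⟩ := ih N₁ N₂
        refine ⟨N + 1, fun {ι} _ V hV c => ?_⟩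
        -- Classical vertex argument: colour the r-sets avoiding a by the colour of S ∪ {a}, pass to
        -- a homogeneous W, and recurse inside W.
        obtain ⟨a, ha⟩ : V.Nonempty := card_pos.1 (by omega)
        have extend : ∀ {m : ℕ} {D : Finset ι → Prop} {W W' : Finset ι}, W ⊆ V.erase a → W' ⊆ W →
            (∀ S ⊆ W, #S = r → D (insert a S)) → #W' = m → (∀ S ⊆ W', #S = r + 1 → D S) →
            insert a W' ⊆ V ∧ #(insert a W') = m + 1 ∧
              ∀ S ⊆ insert a W', #S = r + 1 → D S := by
          intro m D W W' hW hW' hD hm hD'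
          have haW : a ∉ W' := fun h => by simpa using hW (hW' h)
          refine ⟨insert_subset ha ((hW'.trans hW).trans (erase_subset _ _)),
            by rw [card_insert_of_notMem haW, hm], fun S hS hr => ?_⟩
          by_cases haS : a ∈ S
          · rw [← insert_erase haS]
            exact hD _ ((subset_insert_iff.1 hS).trans hW') (by rw [card_erase_of_mem haS, hr]; rfl)
          · exact hD' S ((subset_insert_iff_of_notMem haS).1 hS) hr
        rcases h (V.erase a) (by rw [card_erase_of_mem ha]; omega) (fun S => c (insert a S)) with
          ⟨W, hW, hc, hS⟩ | ⟨W, hW, hc, hS⟩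
        · rcases h₁ W hc.ge c with ⟨W', hW', hc', hS'⟩ | ⟨W', hW', hc', hS'⟩
          · obtain ⟨e1, e2, e3⟩ := extend hW hW' hS hc' hS'
            exact .inl ⟨_, e1, e2, e3⟩
          · exact .inr ⟨W', (hW'.trans hW).trans (erase_subset _ _), hc', hS'⟩
        · rcases h₂ W hc.ge c with ⟨W', hW', hc', hS'⟩ | ⟨W', hW', hc', hS'⟩
          · exact .inl ⟨W', (hW'.trans hW).trans (erase_subset _ _), hc', hS'⟩
          · obtain ⟨e1, e2, e3⟩ := extend (D := fun S => ¬ c S) hW hW' hS hc' hS'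
            exact .inr ⟨_, e1, e2, e3⟩

end Ramsey

/-! ### Antiperiodic functions of the weight against polynomials -/

section Correlation

open Finset

variable {ι : Type} [DecidableEq ι]

lemma sum_powerset_union {M : Type*} [AddCommMonoid M] {B Y : Finset ι} (h : Disjoint B Y)
    (g : Finset ι → M) : ∑ A ∈ (B ∪ Y).powerset, g A =
      ∑ U ∈ Y.powerset, ∑ T ∈ B.powerset, g (T ∪ U) := by
  rw [← sum_product']
  refine sum_nbij' (fun A => (A ∩ Y, A ∩ B)) (fun p => p.2 ∪ p.1) ?_ ?_ ?_ ?_ ?_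
  · intro A _; simp [inter_subset_right]
  · rintro ⟨U, T⟩ hp
    simp only [mem_product, mem_powerset] at hp ⊢
    exact union_subset_union hp.2 hp.1
  · intro A hA
    rw [mem_powerset] at hA
    rw [← inter_union_distrib_left, inter_eq_left.2 hA]
  · rintro ⟨U, T⟩ hp
    simp only [mem_product, mem_powerset] at hp
    have h1 : T ∩ Y = ∅ := disjoint_iff_inter_eq_empty.1 (h.mono_left hp.2)
    have h2 : U ∩ B = ∅ := disjoint_iff_inter_eq_empty.1 (h.symm.mono_left hp.1)
    simp [union_inter_distrib_right, h1, h2, inter_eq_left.2 hp.1, inter_eq_left.2 hp.2]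
  · intro A hA
    rw [mem_powerset] at hA
    rw [← inter_union_distrib_left, inter_eq_left.2 hA]

lemma sum_powerset_of_subset {M : Type*} [AddCommMonoid M] {W V : Finset ι} (h : W ⊆ V)
    (g : Finset ι → M) : ∑ A ∈ V.powerset, g A =
      ∑ U ∈ (V \ W).powerset, ∑ T ∈ W.powerset, g (T ∪ U) := by
  rw [← sum_powerset_union disjoint_sdiff, union_sdiff_of_subset h]

lemma card_union_of_subsets {W V T U : Finset ι} (hT : T ∈ W.powerset) (hU : U ∈ (V \ W).powerset) :
    #(T ∪ U) = #U + #T := by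
  rw [mem_powerset] at hT hU
  rw [card_union_of_disjoint (disjoint_sdiff.mono hT hU), add_comm]

/-- Bounding each fibre of `V.powerset` over `(V \ W).powerset`. -/
lemma norm_sum_powerset_le {W V : Finset ι} (h : W ⊆ V) (g : Finset ι → ℂ) (C : ℝ)
    (hC : ∀ U ∈ (V \ W).powerset, ‖∑ T ∈ W.powerset, g (T ∪ U)‖ ≤ C * 2 ^ #W) :
    ‖∑ A ∈ V.powerset, g A‖ ≤ C * 2 ^ #V := by
  rw [sum_powerset_of_subset h]
  refine (norm_sum_le_of_le _ hC).trans (le_of_eq ?_)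
  rw [sum_const, card_powerset, nsmul_eq_mul, ← card_sdiff_add_card_eq_card h]
  push_cast
  ring

/-- The subsets ∅ and W have weights differing by 2^k, so their terms cancel and 2^{2^k} - 2 remain.
-/
lemma norm_sum_powerset_antiperiodic_le {k : ℕ} {φ : ℕ → ℂ} (hφ : ∀ m, φ (m + 2 ^ k) = -φ m) {C : ℝ}
    (hC : ∀ m, ‖φ m‖ ≤ C) {W : Finset ι} (hW : #W = 2 ^ k) (m : ℕ) :
    ‖∑ B ∈ W.powerset, φ (m + #B)‖ ≤ (2 ^ 2 ^ k - 2) * C := by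
  have hpos := Nat.two_pow_pos k
  have hne : W ≠ ∅ := by rintro rfl; simp at hW; omega
  have hmem : W ∈ W.powerset.erase ∅ := by simp [hne]
  rw [← add_sum_erase _ _ (empty_mem_powerset W), ← add_sum_erase _ _ hmem, hW, hφ, card_empty,
    add_zero, add_neg_cancel_left]
  refine (norm_sum_le_of_le _ fun B _ => hC (m + #B)).trans (le_of_eq ?_)
  rw [sum_const, card_erase_of_mem hmem, card_erase_of_mem (empty_mem_powerset W), card_powerset,
    hW, nsmul_eq_mul, Nat.sub_sub, Nat.cast_sub (by
      calc 1 + 1 = 2 ^ 1 := rfl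
        _ ≤ _ := Nat.pow_le_pow_right (by norm_num) hpos)]
  push_cast
  norm_num

/-- Summing over one block of 2^k coordinates leaves an antiperiodic function of the remaining
weight, so the gain multiplies over the q blocks. -/
lemma norm_sum_antiperiodic_card_le {k : ℕ} (q : ℕ) {φ : ℕ → ℂ} (hφ : ∀ m, φ (m + 2 ^ k) = -φ m)
    {C : ℝ} (hC : ∀ m, ‖φ m‖ ≤ C) {V : Finset ι} (hV : #V = q * 2 ^ k) :
    ‖∑ A ∈ V.powerset, φ #A‖ ≤ (2 ^ 2 ^ k - 2) ^ q * C := by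
  induction q generalizing φ C V with
  | zero =>
    obtain rfl : V = ∅ := by simpa using hV
    simpa using hC 0
  | succ q ih =>
    obtain ⟨W, hW, hc⟩ := exists_subset_card_eq (show 2 ^ k ≤ #V by rw [hV]; nlinarith)
    rw [sum_powerset_of_subset hW]
    have e : ∑ U ∈ (V \ W).powerset, ∑ T ∈ W.powerset, φ #(T ∪ U) =
        ∑ U ∈ (V \ W).powerset, ∑ T ∈ W.powerset, φ (#U + #T) :=
      sum_congr rfl fun U hU => sum_congr rfl fun T hT => by rw [card_union_of_subsets hT hU]
    rw [e]
    have := ih (φ := fun m => ∑ T ∈ W.powerset, φ (m + #T)) (C := (2 ^ 2 ^ k - 2) * C)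
      (V := V \ W) (fun m => by
        simp only [← sum_neg_distrib, ← hφ]
        exact sum_congr rfl fun T _ => by rw [add_right_comm])
      (norm_sum_powerset_antiperiodic_le hφ hC hc)
      (by rw [card_sdiff_of_subset hW, hV, hc, add_mul, one_mul, Nat.add_sub_cancel])
    refine this.trans (le_of_eq ?_)
    ring

lemma exists_norm_sum_antiperiodic_le (k : ℕ) {ε : ℝ} (hε : 0 < ε) :
    ∃ N : ℕ, ∀ {ι : Type} [DecidableEq ι] (V : Finset ι), N ≤ #V → ∀ φ : ℕ → ℂ,
      (∀ m, φ (m + 2 ^ k) = -φ m) → (∀ m, ‖φ m‖ ≤ 1) →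
        ‖∑ A ∈ V.powerset, φ #A‖ ≤ ε * 2 ^ #V := by
  have hp : (0 : ℝ) < 2 ^ 2 ^ k := by positivity
  obtain ⟨q, hq⟩ := exists_pow_lt_of_lt_one hε
    (show ((2 : ℝ) ^ 2 ^ k - 2) / 2 ^ 2 ^ k < 1 by rw [div_lt_one hp]; linarith)
  refine ⟨q * 2 ^ k, fun V hV φ hφ h1 => ?_⟩
  obtain ⟨W, hW, hc⟩ := exists_subset_card_eq hV
  refine norm_sum_powerset_le hW (fun A => φ #A) ε fun U hU => ?_
  have e : ∑ T ∈ W.powerset, φ #(T ∪ U) = ∑ T ∈ W.powerset, φ (#T + #U) :=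
    sum_congr rfl fun T hT => by rw [card_union_of_subsets hT hU, add_comm]
  rw [e]
  refine (norm_sum_antiperiodic_card_le q (φ := fun m => φ (m + #U))
    (fun m => by rw [add_right_comm, hφ]) (fun m => h1 _) hc).trans ?_
  rw [div_pow, div_lt_iff₀ (by positivity)] at hq
  rw [mul_one, hc, mul_comm q, pow_mul]
  exact hq.le

/-- Antiperiodic functions of the weight are asymptotically uncorrelated with phases of
polynomials of degree `j < 2 ^ k`, given here by their coefficients `c`. -/
theorem exists_norm_sum_mul_stdAddChar_le (k j : ℕ) (hj : j < 2 ^ k) {ε : ℝ} (hε : 0 < ε) :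
    ∃ N : ℕ, ∀ {ι : Type} [DecidableEq ι] (V : Finset ι), N ≤ #V → ∀ φ : ℕ → ℂ,
      (∀ m, φ (m + 2 ^ k) = -φ m) → (∀ m, ‖φ m‖ ≤ 1) → ∀ c : Finset ι → ZMod 2,
      (∀ S ⊆ V, j < #S → c S = 0) →
        ‖∑ A ∈ V.powerset, φ #A * ZMod.stdAddChar (∑ S ∈ A.powerset, c S)‖ ≤ ε * 2 ^ #V := by
  induction j with
  | zero =>
    obtain ⟨N, hN⟩ := exists_norm_sum_antiperiodic_le k hε
    refine ⟨N, fun V hV φ hφ h1 c hc => ?_⟩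
    have e : ∑ A ∈ V.powerset, φ #A * (ZMod.stdAddChar (∑ S ∈ A.powerset, c S) : ℂ) =
        (∑ A ∈ V.powerset, φ #A) * ZMod.stdAddChar (c ∅) := by
      rw [sum_mul]
      refine sum_congr rfl fun A hA => ?_
      rw [sum_eq_single_of_mem ∅ (empty_mem_powerset A) fun S hS hne =>
        hc S ((mem_powerset.1 hS).trans (mem_powerset.1 hA)) (card_pos.2 (nonempty_iff_ne_empty.2 hne))]
    rw [e, norm_mul, AddChar.norm_apply, mul_one]
    exact hN V hV φ hφ h1
  | succ j ih =>
    obtain ⟨N₀, h₀⟩ := ih (by omega)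
    obtain ⟨N, hN⟩ := exists_homogeneous_subset (j + 1) N₀ N₀
    refine ⟨N, fun {ι} _ V hV φ hφ h1 c hc => ?_⟩
    obtain ⟨W, b, hW, hcard, hb⟩ : ∃ (W : Finset ι) (b : ZMod 2), W ⊆ V ∧ #W = N₀ ∧
        ∀ S ⊆ W, #S = j + 1 → c S = b := by
      rcases hN V hV (fun S => c S = 1) with ⟨W, hW, hc, hS⟩ | ⟨W, hW, hc, hS⟩
      · exact ⟨W, 1, hW, hc, hS⟩
      · refine ⟨W, 0, hW, hc, fun S h h' => ?_⟩
        have := hS S h h'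
        revert this
        generalize c S = a
        revert a
        decide
    refine norm_sum_powerset_le hW
      (fun A => φ #A * ZMod.stdAddChar (∑ S ∈ A.powerset, c S)) ε fun U hU => ?_
    have hUW := mem_powerset.1 hU
    -- On the fibre over U, `c'` holds the coefficients of the restricted polynomial without its
    -- degree j+1 part. That part is b·C(|T|, j+1), which `φ'` absorbs.
    let c' : Finset ι → ZMod 2 := fun T =>
      ∑ R ∈ U.powerset, c (T ∪ R) - if #T = j + 1 then b else 0
    let φ' : ℕ → ℂ := fun m => φ (m + #U) * ZMod.stdAddChar (b * ((m.choose (j + 1) : ℕ) : ZMod 2))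
    have e : ∑ T ∈ W.powerset, φ #(T ∪ U) * (ZMod.stdAddChar (∑ S ∈ (T ∪ U).powerset, c S) : ℂ) =
        ∑ T ∈ W.powerset, φ' #T * ZMod.stdAddChar (∑ S ∈ T.powerset, c' S) := by
      refine sum_congr rfl fun T hT => ?_
      rw [card_union_of_subsets hT hU, add_comm #U, mul_assoc, ← AddChar.map_add_eq_mul,
        sum_powerset_union (disjoint_sdiff.mono (mem_powerset.1 hT) hUW), sum_comm,
        sum_sub_distrib, ← sum_filter, ← powersetCard_eq_filter, sum_const, card_powersetCard,
        nsmul_eq_mul, mul_comm b, add_sub_cancel]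
    rw [e]
    refine h₀ W hcard.ge φ' (fun m => ?_) (fun m => ?_) c' (fun S hS hjS => ?_)
    · simp only [φ']
      rw [choose_add_two_pow k m _ hj, add_right_comm, hφ, neg_mul]
    · simp only [φ', norm_mul, AddChar.norm_apply, mul_one]
      exact h1 _
    -- For |S| = j+1 only R = ∅ respects the degree bound and contributes b, which is subtracted;
    -- for |S| > j+1 every term vanishes.
    · have hlt : ∀ R ∈ U.powerset, j + 1 < #(S ∪ R) → c (S ∪ R) = 0 := fun R hR h =>
        hc _ (union_subset (hS.trans hW)
          (((mem_powerset.1 hR).trans hUW).trans sdiff_subset)) h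
      have hc2 : ∀ R ∈ U.powerset, #(S ∪ R) = #R + #S := fun R hR =>
        card_union_of_subsets (mem_powerset.2 hS) (mem_powerset.2 ((mem_powerset.1 hR).trans hUW))
      simp only [c']
      split_ifs with hS1
      · rw [sum_eq_single_of_mem ∅ (empty_mem_powerset U), union_empty, hb S hS hS1, sub_self]
        intro R hR hne
        have := card_pos.2 (nonempty_iff_ne_empty.2 hne)
        exact hlt R hR (by rw [hc2 R hR]; omega)
      · rw [sub_zero]
        exact sum_eq_zero fun R hR => hlt R hR (by rw [hc2 R hR]; omega)

end Correlation

/-! ### Decay of the weak norm for d = 2^k -/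

section WeakNorm

open Finset

/-- The indicator vector of a set of coordinates. -/
def indVec {n : ℕ} (A : Finset (Fin n)) : Fin n → ZMod 2 := fun i => if i ∈ A then 1 else 0

lemma wt_indVec {n : ℕ} (A : Finset (Fin n)) : wt (indVec A) = #A := by
  simp [wt, indVec]

lemma indVec_bijective (n : ℕ) : Function.Bijective (indVec (n := n)) := by
  rw [Fintype.bijective_iff_injective_and_card]
  constructor
  · intro A B h
    ext i
    have := congrFun h i
    by_cases hA : i ∈ A <;> by_cases hB : i ∈ B <;> simp_all [indVec]
  · simp

/-- Möbius inversion over 𝔽₂: subset summation is its own inverse, so it converts values to monomial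
coefficients and back. -/
lemma sum_powerset_sum_powerset {ι : Type*} [DecidableEq ι] (A : Finset ι)
    (P : Finset ι → ZMod 2) : ∑ S ∈ A.powerset, ∑ B ∈ S.powerset, P B = P A := by
  induction A using Finset.induction_on generalizing P with
  | empty => simp
  | insert a A ha ih =>
    rw [sum_powerset_insert ha]
    have : ∑ S ∈ A.powerset, ∑ B ∈ (insert a S).powerset, P B =
        ∑ S ∈ A.powerset, (∑ B ∈ S.powerset, P B + ∑ B ∈ S.powerset, P (insert a B)) :=
      sum_congr rfl fun S hS => sum_powerset_insert (fun h => ha (mem_powerset.1 hS h)) _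
    rw [this, sum_add_distrib, ih, ih (fun B => P (insert a B)), ← add_assoc,
      CharTwo.add_self_eq_zero, zero_add]

lemma foldr_fwdDiff_single {n : ℕ} (P : (Fin n → ZMod 2) → ZMod 2) (l : List (Fin n))
    (hl : l.Nodup) (x : Fin n → ZMod 2) :
    (l.map fun i => (Pi.single i 1 : Fin n → ZMod 2)).foldr fwdDiff P x =
      ∑ A ∈ l.toFinset.powerset, P (x + indVec A) := by
  induction l generalizing x with
  | nil =>
    have : indVec (∅ : Finset (Fin n)) = 0 := by ext; simp [indVec]
    simp [this]
  | cons a l ih =>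
    rw [List.nodup_cons] at hl
    have ha : a ∉ l.toFinset := by simpa using hl.1
    rw [List.map_cons, List.foldr_cons, fwdDiff, ih hl.2, ih hl.2, List.toFinset_cons,
      sum_powerset_insert ha, CharTwo.sub_eq_add, add_comm]
    congr 1
    refine sum_congr rfl fun A hA => ?_
    congr 1
    ext i
    have haA : a ∉ A := fun h => ha (mem_powerset.1 hA h)
    rw [Pi.add_apply, Pi.add_apply, Pi.add_apply, add_assoc]
    congr 1
    rcases eq_or_ne i a with rfl | hi
    · simp [indVec, haA]
    · simp [indVec, hi]

/-- The coefficient at S is the derivative at 0 along the basis vectors of S. -/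
lemma sum_powerset_indVec_eq_zero {n d : ℕ} {P : (Fin n → ZMod 2) → ZMod 2} (hP : DegLT d P)
    {S : Finset (Fin n)} (hS : d ≤ #S) : ∑ A ∈ S.powerset, P (indVec A) = 0 := by
  have h := foldr_fwdDiff_single P S.toList S.nodup_toList 0
  rw [hP _ (by simpa using hS)] at h
  simpa using h.symm

lemma exists_weakGowersNorm_le (k : ℕ) {ε : ℝ} (hε : 0 < ε) :
    ∃ N : ℕ, ∀ n ≥ N, weakGowersNorm (2 ^ k) (signSymm n (2 ^ k)) ≤ ε := by
  have hpos := Nat.two_pow_pos k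
  obtain ⟨N, hN⟩ := exists_norm_sum_mul_stdAddChar_le k (2 ^ k - 1) (by omega) hε
  refine ⟨N, fun n hn => Real.iSup_le (fun ⟨Q, hQ⟩ => ?_) hε.le⟩
  have hQ := (mem_polyDegLE_iff.1 hQ).neg
  rw [Nat.sub_add_cancel hpos] at hQ
  have key := hN (univ : Finset (Fin n)) (by simpa using hn)
    (fun m => ZMod.stdAddChar ((m.choose (2 ^ k) : ℕ) : ZMod 2))
    (fun m => by
      rw [choose_add_two_pow_self, AddChar.map_add_eq_mul]
      simp [stdAddChar_two 1, ZMod.val_one])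
    (fun m => (AddChar.norm_apply _ _).le)
    (fun S => ∑ A ∈ S.powerset, -Q (indVec A))
    (fun S _ hS => sum_powerset_indVec_eq_zero hQ (by omega))
  rw [Fintype.expect_eq_sum_div_card, norm_div]
  have hcard : ‖(Fintype.card (Fin n → ZMod 2) : ℂ)‖ = 2 ^ n := by simp
  rw [hcard, div_le_iff₀ (by positivity)]
  refine le_trans (le_of_eq (congrArg norm ?_)) (key.trans (by simp))
  rw [powerset_univ]
  refine ((indVec_bijective n).sum_comp _).symm.trans (sum_congr rfl fun A _ => ?_)
  rw [sum_powerset_sum_powerset A fun B => -Q (indVec B), signSymm_eq, symmFun_eq_choose, wt_indVec]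

lemma tendsto_weakGowersNorm (k : ℕ) :
    Filter.Tendsto (fun n : ℕ => weakGowersNorm (2 ^ k) (signSymm n (2 ^ k))) Filter.atTop
      (nhds 0) := by
  rw [Metric.tendsto_atTop]
  intro ε hε
  obtain ⟨N, hN⟩ := exists_weakGowersNorm_le k (half_pos hε)
  refine ⟨N, fun n hn => ?_⟩
  rw [Real.dist_eq, sub_zero, abs_of_nonneg (weakGowersNorm_nonneg _ _)]
  linarith [hN n hn]

end WeakNorm
-- The degrees 1 and 2
section SmallDegree

open Finset

lemma expect_eq_zero_of_neg_translate {G : Type*} [AddCommGroup G] [Fintype G] {f : G → ℂ} (t : G)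
    (h : ∀ x, f (x + t) = -f x) : 𝔼 x, f x = 0 := by
  have e : 𝔼 x, f x = 𝔼 x, f (x + t) :=
    (Fintype.expect_equiv (Equiv.addRight t) _ _ fun x => rfl).symm
  simp only [h, expect_neg_distrib] at e
  exact self_eq_neg.1 e

lemma symmFun_one (n : ℕ) (x : Fin n → ZMod 2) : symmFun 2 n 1 x = ∑ i, x i := by
  simp [symmFun_eq_sum, powersetCard_one]

lemma sum_powersetCard_two_add {ι : Type*} [DecidableEq ι] (V : Finset ι) (x h : ι → ZMod 2) :
    ∑ s ∈ powersetCard 2 V, ∏ i ∈ s, (x i + h i) =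
      ∑ s ∈ powersetCard 2 V, ∏ i ∈ s, x i + ∑ s ∈ powersetCard 2 V, ∏ i ∈ s, h i
        + (∑ i ∈ V, x i) * ∑ i ∈ V, h i + ∑ i ∈ V, x i * h i := by
  have hrec (a : ι) (V : Finset ι) (ha : a ∉ V) (y : ι → ZMod 2) :
      ∑ s ∈ powersetCard 2 (insert a V), ∏ i ∈ s, y i =
        ∑ s ∈ powersetCard 2 V, ∏ i ∈ s, y i + y a * ∑ i ∈ V, y i := by
    rw [powersetCard_succ_insert ha, sum_union, powersetCard_one, sum_image, sum_map, mul_sum]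
    · congr 1
      refine sum_congr rfl fun i hi => ?_
      have : a ≠ i := by rintro rfl; exact ha hi
      simp [prod_pair this]
    · intro s hs t ht hst
      simp only [coe_map, Set.mem_image, mem_coe] at hs ht
      obtain ⟨i, hi, rfl⟩ := hs
      obtain ⟨j, hj, rfl⟩ := ht
      have hai : a ∉ ({i} : Finset ι) := by rw [mem_singleton]; rintro rfl; exact ha hi
      have haj : a ∉ ({j} : Finset ι) := by rw [mem_singleton]; rintro rfl; exact ha hj
      exact (erase_insert hai).symm.trans ((congrArg (fun u => u.erase a) hst).trans (erase_insert haj))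
    · rw [disjoint_left]
      intro s hs hs'
      obtain ⟨t, _, rfl⟩ := mem_image.1 hs'
      exact ha ((mem_powersetCard.1 hs).1 (mem_insert_self _ _))
  induction V using Finset.induction_on with
  | empty => simp [powersetCard_eq_empty.2 (show #(∅ : Finset ι) < 2 by simp)]
  | insert a V ha ih =>
    simp only [hrec a V ha, sum_insert ha, ih, sum_add_distrib]
    -- The product of sums and the diagonal sum each contribute x_a h_a; together they vanish in
    -- characteristic two.
    linear_combination (-(x a * h a)) * CharTwo.two_eq_zero (R := ZMod 2)

lemma symmFun_two_add (n : ℕ) (x h : Fin n → ZMod 2) :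
    symmFun 2 n 2 (x + h) = symmFun 2 n 2 x + symmFun 2 n 2 h
      + (∑ i, x i) * (∑ i, h i) + ∑ i, x i * h i := by
  simpa [symmFun_eq_sum] using sum_powersetCard_two_add univ x h

/-- The derivative of `S_2` along h is affine with j-th slope h_j + ∑ h_i, here equal to 1, so
flipping x_j changes the sign. -/
lemma expect_mulDeriv_signSymm_two {n : ℕ} (h : Fin n → ZMod 2) (j : Fin n)
    (hj : h j ≠ ∑ i, h i) : 𝔼 x, mulDeriv h (signSymm n 2) x = 0 := by
  have e : mulDeriv h (signSymm n 2) =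
      fun x => ZMod.stdAddChar (fwdDiff h (symmFun 2 n 2) x) := by
    rw [← mulDeriv_stdAddChar_comp]
    congr 1
    ext x; exact signSymm_eq n 2 x
  refine expect_eq_zero_of_neg_translate (Pi.single j 1) fun x => ?_
  have hd : fwdDiff h (symmFun 2 n 2) (x + Pi.single j 1) =
      fwdDiff h (symmFun 2 n 2) x + 1 := by
    have h1 : ∑ i, h i + h j = 1 := by
      revert hj
      generalize h j = a
      generalize ∑ i, h i = b
      revert a b
      decide
    simp only [fwdDiff, symmFun_two_add, Pi.add_apply, sum_add_distrib, add_mul]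
    simp only [Pi.single_apply, ite_mul, one_mul, zero_mul, sum_ite_eq', mem_univ, if_true]
    linear_combination h1
  rw [e]
  simp only [hd, AddChar.map_add_eq_mul, stdAddChar_two 1, ZMod.val_one]
  simp

/-- Only constant vectors h can give a derivative with nonzero mean, hence at most 2 of the 2^n
directions count. -/
lemma norm_expect_iterMulDeriv_signSymm_two_le (n : ℕ) :
    ‖𝔼 h : Fin 2 → Fin n → ZMod 2, 𝔼 x, iterMulDeriv h (signSymm n 2) x‖ ≤ 2 * (1 / 2) ^ n := by
  have hf (h : Fin n → ZMod 2) (x) : ‖mulDeriv h (signSymm n 2) x‖ = 1 := by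
    simp [mulDeriv, signSymm_eq, AddChar.norm_apply]
  have hle (h : Fin n → ZMod 2) : ‖𝔼 x, mulDeriv h (signSymm n 2) x‖ ^ 2 ≤
      if h = 0 ∨ h = 1 then 1 else 0 := by
    split_ifs with hh
    · refine pow_le_one₀ (norm_nonneg _) ((RCLike.norm_expect_le (K := ℂ)).trans ?_)
      simp only [hf, Fintype.expect_const, le_refl]
    · obtain ⟨j, hj⟩ : ∃ j, h j ≠ ∑ i, h i := by
        by_contra! hc
        apply hh
        have : ∀ a : ZMod 2, a = 0 ∨ a = 1 := by decide
        refine (this (∑ i, h i)).imp (fun e => ?_) (fun e => ?_) <;> ext i <;> exact (hc i).trans e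
      rw [expect_mulDeriv_signSymm_two h j hj]
      simp
  rw [expect_iterMulDeriv_succ, Complex.norm_real,
    Real.norm_of_nonneg (expect_nonneg fun _ _ => by positivity)]
  have e : 𝔼 h : Fin 1 → Fin n → ZMod 2, ‖𝔼 x, iterMulDeriv h (signSymm n 2) x‖ ^ 2 =
      𝔼 h : Fin n → ZMod 2, ‖𝔼 x, mulDeriv h (signSymm n 2) x‖ ^ 2 :=
    Fintype.expect_equiv (Equiv.funUnique (Fin 1) _) _ _ fun h => by simp [iterMulDeriv]
  rw [e]
  refine (expect_le_expect fun h _ => hle h).trans ?_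
  rw [Fintype.expect_eq_sum_div_card, sum_boole]
  have hc : #{h : Fin n → ZMod 2 | h = 0 ∨ h = 1} ≤ 2 := by
    refine (card_le_card (t := {0, 1}) fun h => ?_).trans card_le_two
    simp
  have hcard : (Fintype.card (Fin n → ZMod 2) : ℝ) = 2 ^ n := by simp
  rw [hcard, one_div, inv_pow, div_eq_mul_inv]
  gcongr
  exact_mod_cast hc

lemma tendsto_gowersNorm_two :
    Filter.Tendsto (fun n : ℕ => gowersNorm 2 (signSymm n 2)) Filter.atTop (nhds 0) := by
  have h : Filter.Tendsto (fun n : ℕ => (2 * (1 / 2 : ℝ) ^ n) ^ ((1 : ℝ) / 2 ^ 2))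
      Filter.atTop (nhds 0) := by
    have h0 : Filter.Tendsto (fun n : ℕ => 2 * (1 / 2 : ℝ) ^ n) Filter.atTop (nhds 0) := by
      simpa using (tendsto_pow_atTop_nhds_zero_of_lt_one (r := (1 / 2 : ℝ)) (by norm_num)
        (by norm_num)).const_mul 2
    have := h0.rpow_const (p := (1 : ℝ) / 2 ^ 2) (Or.inr (by positivity))
    rwa [Real.zero_rpow (by norm_num)] at this
  exact squeeze_zero (fun n => gowersNorm_nonneg _ _) (fun n =>
    Real.rpow_le_rpow (norm_nonneg _) (norm_expect_iterMulDeriv_signSymm_two_le n)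
      (by positivity)) h

lemma gowersNorm_one_signSymm {n : ℕ} (hn : 1 ≤ n) : gowersNorm 1 (signSymm n 1) = 0 := by
  have h : 𝔼 x, signSymm n 1 x = 0 := by
    refine expect_eq_zero_of_neg_translate (Pi.single ⟨0, hn⟩ 1) fun x => ?_
    simp [signSymm_eq, symmFun_one, sum_add_distrib, AddChar.map_add_eq_mul, stdAddChar_two 1,
      ZMod.val_one]
  rw [gowersNorm, expect_iterMulDeriv_succ]
  simp [iterMulDeriv, h]

lemma tendsto_gowersNorm_one :
    Filter.Tendsto (fun n : ℕ => gowersNorm 1 (signSymm n 1)) Filter.atTop (nhds 0) :=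
  tendsto_const_nhds.congr' <| by
    filter_upwards [Filter.eventually_ge_atTop 1] with n hn
    exact (gowersNorm_one_signSymm hn).symm

end SmallDegree

lemma two_le_of_four_le_two_pow {k : ℕ} (h : 4 ≤ 2 ^ k) : 2 ≤ k := by
  by_contra! hk
  interval_cases k <;> omega

lemma not_gowersInverseConjecture {k : ℕ} (hk : 2 ≤ k) : ¬ GowersInverseConjecture 2 (2 ^ k) := by
  intro H
  obtain ⟨c, hc, h⟩ := H (1 / 2) (by norm_num) (by norm_num)
  obtain ⟨N, hN⟩ := exists_weakGowersNorm_le k (half_pos hc)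
  have h1 := h N (signSymm N (2 ^ k))
    (fun x => by rw [signSymm_eq, AddChar.norm_apply]) (half_le_gowersNorm hk)
  linarith [hN N le_rfl]

theorem mainTheorem4 :
    -- the cases `d = 1` and `d = 2`
    (∀ d : ℕ, d = 1 ∨ d = 2 →
      Filter.Tendsto (fun n : ℕ => gowersNorm d (signSymm n d)) Filter.atTop (nhds 0) ∧
      Filter.Tendsto (fun n : ℕ => weakGowersNorm d (signSymm n d)) Filter.atTop (nhds 0)) ∧
    -- the case where `d` is not a power of `2`
    (∀ d : ℕ, 1 ≤ d → (¬ ∃ j : ℕ, d = 2 ^ j) → ∀ n : ℕ, 1 ≤ n →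
      polyRank (d - 1) (symmFun 2 n d) ≤ 2 ∧
      weakGowersNorm d (signSymm n d) ≤ gowersNorm d (signSymm n d) ∧
      1 / 4 ≤ weakGowersNorm d (signSymm n d)) ∧
    -- the case where `d ≥ 4` is a power of `2`; the lower bound `c` is absolute
    (∃ c : ℝ, 0 < c ∧ ∀ d : ℕ, 4 ≤ d → (∃ j : ℕ, d = 2 ^ j) → ∀ n : ℕ, 1 ≤ n →
      c ≤ gowersNorm d (signSymm n d)) ∧
    (∀ d : ℕ, 4 ≤ d → (∃ j : ℕ, d = 2 ^ j) →
      Filter.Tendsto (fun n : ℕ => weakGowersNorm d (signSymm n d)) Filter.atTop (nhds 0) ∧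
      ¬ GowersInverseConjecture 2 d) := by
  refine ⟨?_, fun d hd h n _ => ⟨polyRank_symmFun_le hd h, weakGowersNorm_le_gowersNorm d hd _,
    quarter_le_weakGowersNorm hd h⟩, ⟨1 / 2, by norm_num, ?_⟩, ?_⟩
  · rintro d (rfl | rfl)
    -- The weak-norm decay holds for all k, so it also covers 1 = 2^0 and 2 = 2^1.
    · exact ⟨tendsto_gowersNorm_one, tendsto_weakGowersNorm 0⟩
    · exact ⟨tendsto_gowersNorm_two, tendsto_weakGowersNorm 1⟩
  · rintro d hd ⟨k, rfl⟩ n -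
    exact half_le_gowersNorm (two_le_of_four_le_two_pow hd)
  · rintro d hd ⟨k, rfl⟩
    exact ⟨tendsto_weakGowersNorm k, not_gowersInverseConjecture (two_le_of_four_le_two_pow hd)⟩
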